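/- Let $\xi$ be a complex random variable that is sub-Gaussian (there are constants $c,C>0$ with $\mathbb{P}[|\xi|>t]\le Ce^{-ct^2}$ for all $t\ge 0$) and whose law has a continuous density with respect to Lebesgue measure on $\mathbb{C}\cong\mathbb{R}^2$ that is bounded by a constant $K$. Let $G_n$ be a random $n\times n$ matrix such that the entries of $n^{1/2}G_n$ are independent copies of $\xi$. Let $A\in\mathbb{C}^{n\times n}$ with $\|A\|\le 1$ (the $\ell^2\to\ell^2$ operator norm), let $\delta\in(0,1)$, and let $\lambda_1,\dots,\lambda_n$ be the (random) eigenvalues of $A+\delta G_n$. Then $\lambda_1,\dots,\lambda_n$ are almost surely distinct, and for every open set $B\subseteq\mathbb{C}$, $$\mathbb{E}\sum_{\lambda_i\in B}\kappa(\lambda_i)^2\le\frac{eKn^3}{\delta^2}\operatorname{vol}(B).$$ Here $\operatorname{vol}$ is Lebesgue measure on $\mathbb{C}$, and, for a matrix $M=\sum_{i=1}^n\lambda_iv_iw_i^\dagger=VDV^{-1}$ with distinct eigenvalues $\lambda_i$, where $v_i$ is the $i$-th column of $V$ and $w_i^\dagger$ is the $i$-th row of $V^{-1}$ (so $w_i^\dagger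 v_i=1$), $\kappa(\lambda_i)=\kappa(\lambda_i,M)=\|v_i\|_2\|w_i\|_2$ is the eigenvalue condition number. The left-hand side is in particular well defined, i.e. the sum is almost surely equal to a measurable function with values in $[0,\infty]$. -/

import Mathlib

open MeasureTheory ProbabilityTheory
open scoped ENNReal

noncomputable section

/-- A complex random variable `X` is sub-Gaussian if there are constants `c, C > 0` with
`P(|X| > t) ≤ C exp(-c t²)` for all `t ≥ 0`. -/
def IsSubGaussian {Ω : Type*} [MeasurableSpace Ω] (X : Ω → ℂ) (P : Measure Ω) : Prop :=
  ∃ c C : ℝ, 0 < c ∧ 0 < C ∧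
    ∀ t : ℝ, 0 ≤ t → P {ω | t < ‖X ω‖} ≤ ENNReal.ofReal (C * Real.exp (-(c * t ^ 2)))

/-- The law of `X` has, with respect to Lebesgue measure on `ℂ = ℝ²`, a continuous density that is
bounded by `K`. -/
def HasContDensityLE {Ω : Type*} [MeasurableSpace Ω] (X : Ω → ℂ) (P : Measure Ω) (K : ℝ) : Prop :=
  ∃ f : ℂ → ℝ, Continuous f ∧ (∀ z, 0 ≤ f z) ∧ (∀ z, f z ≤ K) ∧
    Measure.map X P = (volume : Measure ℂ).withDensity (fun z => ENNReal.ofReal (f z))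

/-- `G` is a copy of the random matrix `G_n(ξ)`: the entries of `n^{1/2} G` are independent copies
of `ξ`. -/
structure IsIIDMatrix {Ω Ω' : Type*} [MeasurableSpace Ω] [MeasurableSpace Ω'] {n : ℕ}
    (G : Ω → Matrix (Fin n) (Fin n) ℂ) (P : Measure Ω) (ξ : Ω' → ℂ) (P' : Measure Ω') : Prop where
  indep : iIndepFun (fun (p : Fin n × Fin n) (ω : Ω) => ((√(n : ℝ) : ℝ) : ℂ) * G ω p.1 p.2) P
  identDistrib : ∀ i j, IdentDistrib (fun ω => ((√(n : ℝ) : ℝ) : ℂ) * G ω i j) ξ P P'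

/-- `M = V D V⁻¹` with `V` invertible and `D` diagonal with diagonal `d`. Equivalently,
`M = ∑ i, d i • v i (w i)†`, where `v i` is the `i`-th column of `V` and `(w i)†` is the `i`-th row
of `V⁻¹`, so that `(w i)† v i = 1`. -/
structure IsSpectralExpansion {n : ℕ} (M V : Matrix (Fin n) (Fin n) ℂ) (d : Fin n → ℂ) : Prop where
  isUnit_det : IsUnit V.det
  eq : M = V * Matrix.diagonal d * V⁻¹

/-- The eigenvalue condition number `κ(z, M) = ‖v‖₂ ‖w‖₂`, where `v` and `w†` are the column of `V`
and the row of `V⁻¹` that belong to the eigenvalue `z` in a spectral expansion `M = V D V⁻¹`.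
For a matrix `M` with distinct eigenvalues the product does not depend on the expansion
(`eigenvalueCond_eq`), so the infimum is over one value only. -/
def eigenvalueCond {n : ℕ} (M : Matrix (Fin n) (Fin n) ℂ) (z : ℂ) : ℝ≥0∞ :=
  ⨅ (V : Matrix (Fin n) (Fin n) ℂ) (d : Fin n → ℂ) (i : Fin n)
    (_ : IsSpectralExpansion M V d) (_ : d i = z),
    ‖(WithLp.toLp 2 (fun k => V k i) : EuclideanSpace ℂ (Fin n))‖ₑ *
      ‖(WithLp.toLp 2 (fun k => V⁻¹ i k) : EuclideanSpace ℂ (Fin n))‖ₑ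

theorem eigenvalueCond_eq {n : ℕ} {M V : Matrix (Fin n) (Fin n) ℂ} {d : Fin n → ℂ}
    (h : IsSpectralExpansion M V d) (hd : Function.Injective d) (i : Fin n) :
    eigenvalueCond M (d i) =
      ‖(WithLp.toLp 2 (fun k => V k i) : EuclideanSpace ℂ (Fin n))‖ₑ *
      ‖(WithLp.toLp 2 (fun k => V⁻¹ i k) : EuclideanSpace ℂ (Fin n))‖ₑ := by
  apply le_antisymm
  · exact iInf_le_of_le V (iInf_le_of_le d (iInf_le_of_le i (iInf_le_of_le h
      (iInf_le_of_le rfl le_rfl))))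
  · refine le_iInf fun V' => le_iInf fun d' => le_iInf fun j => le_iInf fun h' =>
      le_iInf fun hj => le_of_eq ?_
    have e := h.eq.symm.trans h'.eq
    have u := h.isUnit_det
    have u' := h'.isUnit_det
    have hT : Matrix.diagonal d * (V⁻¹ * V') = (V⁻¹ * V') * Matrix.diagonal d' := by
      calc Matrix.diagonal d * (V⁻¹ * V')
          = V⁻¹ * V * Matrix.diagonal d * V⁻¹ * V' := by
            rw [Matrix.nonsing_inv_mul _ u, Matrix.one_mul, Matrix.mul_assoc]
        _ = V⁻¹ * (V * Matrix.diagonal d * V⁻¹) * V' := by simp only [Matrix.mul_assoc]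
        _ = V⁻¹ * V' * Matrix.diagonal d' * (V'⁻¹ * V') := by
            rw [e]; simp only [Matrix.mul_assoc]
        _ = _ := by rw [Matrix.nonsing_inv_mul _ u', Matrix.mul_one]
    have hS : Matrix.diagonal d' * (V'⁻¹ * V) = (V'⁻¹ * V) * Matrix.diagonal d := by
      calc Matrix.diagonal d' * (V'⁻¹ * V)
          = V'⁻¹ * V' * Matrix.diagonal d' * V'⁻¹ * V := by
            rw [Matrix.nonsing_inv_mul _ u', Matrix.one_mul, Matrix.mul_assoc]
        _ = V'⁻¹ * (V' * Matrix.diagonal d' * V'⁻¹) * V := by simp only [Matrix.mul_assoc]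
        _ = V'⁻¹ * V * Matrix.diagonal d * (V⁻¹ * V) := by
            rw [← e]; simp only [Matrix.mul_assoc]
        _ = _ := by rw [Matrix.nonsing_inv_mul _ u, Matrix.mul_one]
    have hST : (V'⁻¹ * V) * (V⁻¹ * V') = 1 := by
      calc (V'⁻¹ * V) * (V⁻¹ * V') = V'⁻¹ * (V * V⁻¹) * V' := by simp only [Matrix.mul_assoc]
        _ = 1 := by
          rw [Matrix.mul_nonsing_inv _ u, Matrix.mul_one, Matrix.nonsing_inv_mul _ u']
    have hV' : V' = V * (V⁻¹ * V') := by
      rw [← Matrix.mul_assoc, Matrix.mul_nonsing_inv _ u, Matrix.one_mul]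
    have hW' : V'⁻¹ = (V'⁻¹ * V) * V⁻¹ := by
      rw [Matrix.mul_assoc, Matrix.mul_nonsing_inv _ u, Matrix.mul_one]
    generalize V⁻¹ * V' = T at hT hST hV'
    generalize V'⁻¹ * V = S at hS hST hW'
    have hT0 : ∀ k, k ≠ i → T k j = 0 := by
      intro k hk
      have := congrFun (congrFun hT k) j
      rw [Matrix.diagonal_mul, Matrix.mul_diagonal, hj, mul_comm (T k j)] at this
      by_contra h0
      exact hk (hd (mul_right_cancel₀ h0 this))
    have hS0 : ∀ k, k ≠ i → S j k = 0 := by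
      intro k hk
      have := congrFun (congrFun hS j) k
      rw [Matrix.diagonal_mul, Matrix.mul_diagonal, hj, mul_comm (S j k)] at this
      by_contra h0
      exact hk (hd (mul_right_cancel₀ h0 this)).symm
    have h1 : S j i * T i j = 1 := by
      have := congrFun (congrFun hST j) j
      rwa [Matrix.mul_apply, Finset.sum_eq_single i (fun k _ hk => by rw [hT0 k hk, mul_zero])
        (fun hi => absurd (Finset.mem_univ i) hi), Matrix.one_apply_eq] at this
    have hc : (WithLp.toLp 2 (fun k => V' k j) : EuclideanSpace ℂ (Fin n)) =
        T i j • WithLp.toLp 2 (fun k => V k i) := by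
      ext k
      simp only [PiLp.smul_apply, smul_eq_mul]
      rw [hV', Matrix.mul_apply, Finset.sum_eq_single i
        (fun k _ hk => by rw [hT0 k hk, mul_zero]) (fun hi => absurd (Finset.mem_univ i) hi),
        mul_comm]
    have hr : (WithLp.toLp 2 (fun k => V'⁻¹ j k) : EuclideanSpace ℂ (Fin n)) =
        S j i • WithLp.toLp 2 (fun k => V⁻¹ i k) := by
      ext k
      simp only [PiLp.smul_apply, smul_eq_mul]
      rw [hW', Matrix.mul_apply, Finset.sum_eq_single i
        (fun k _ hk => by rw [hS0 k hk, zero_mul]) (fun hi => absurd (Finset.mem_univ i) hi)]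
    have h2 : ‖T i j‖ₑ * ‖S j i‖ₑ = 1 := by
      rw [← enorm_mul, mul_comm, h1, enorm_one]
    rw [hc, hr, enorm_smul, enorm_smul, mul_mul_mul_comm, h2, one_mul]

/-- `∑_{λ_i ∈ B} κ(λ_i, M)²`, the sum being over the eigenvalues `λ_1, …, λ_n` of `M` (the roots of
its characteristic polynomial) that lie in `B`. -/
def sumSqEigenvalueCond {n : ℕ} (M : Matrix (Fin n) (Fin n) ℂ) (B : Set ℂ) : ℝ≥0∞ :=
  (M.charpoly.roots.map (B.indicator fun z => eigenvalueCond M z ^ 2)).sum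

end

/-! Let `p` be the characteristic polynomial of a matrix `M` with simple spectrum. The identity
`v_i(j) * w_i†(k) = adj(λ_i - M)_{jk} / p'(λ_i)` turns `κ(λ_i)²` into the sum over `j, k` of
`|adj(λ_i - M)_{jk} / p'(λ_i)|²`. Each term is `|∂λ_i/∂M_{kj}|²`, the real Jacobian of the
eigenvalue as a function of a single entry.

Freeze all entries except `m = M_{kj}`. Then `p = a - m b`, where `b = adj(z - M)_{jk}` does not
involve `m`. A point `z` with `b(z) ≠ 0` is an eigenvalue for exactly one `m`, namely `a(z)/b(z)`,
so the change of variables `m = a(z)/b(z)` bounds the integral over `m` of the squared derivatives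
at eigenvalues in `B` by `vol(B)` (`lintegral_sum_roots_sub_C_mul_le`). The entry `M_{kj}` has
density at most `Kn/δ²`; integrating it first and summing over the `n²` pairs gives `Kn³ vol(B)/δ²`,
even without the factor `e`.

Simplicity of the spectrum holds almost surely because the discriminant is a nonzero polynomial in
the entries (`ae_nodup_roots_charpoly`). Measurability follows from lower semicontinuity of the sums
over roots where the roots are simple, by continuity of roots and openness of `B`
(`lowerSemicontinuous_indicator_sum_roots`). -/

/-! ### Dependence of the characteristic polynomial on one matrix entry -/

open Polynomial in
theorem charmatrix_updateRow_add_smul_single {n R : Type*} [DecidableEq n] [Fintype n] [CommRing R]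
    (X : Matrix n n R) (k j : n) (m : R) :
    (X.updateRow k (X k + m • Pi.single j 1)).charmatrix =
      X.charmatrix.updateRow k (X.charmatrix k + (-C m) • Pi.single j 1) := by
  ext1 i l
  rw [Matrix.charmatrix_apply]
  rcases eq_or_ne i k with rfl | hi
  · rcases eq_or_ne l j with rfl | hl
    · simp [Matrix.charmatrix_apply]; ring
    · simp [Matrix.charmatrix_apply, hl]
  · simp [Matrix.charmatrix_apply, hi]

open Polynomial in
theorem charpoly_updateRow_add_smul_single {n R : Type*} [DecidableEq n] [Fintype n] [CommRing R]
    (X : Matrix n n R) (k j : n) (m : R) :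
    (X.updateRow k (X k + m • Pi.single j 1)).charpoly =
      X.charpoly - C m * X.charmatrix.adjugate j k := by
  rw [Matrix.charpoly, charmatrix_updateRow_add_smul_single, Matrix.det_updateRow_add,
    Matrix.det_updateRow_smul, Matrix.updateRow_eq_self, Matrix.adjugate_apply, Matrix.charpoly]
  ring

-- The cofactor overwrites row `k`, so it cannot see a change in that row.
open Polynomial in
theorem adjugate_charmatrix_updateRow_add_smul_single {n R : Type*} [DecidableEq n] [Fintype n]
    [CommRing R] (X : Matrix n n R) (k j : n) (m : R) :
    (X.updateRow k (X k + m • Pi.single j 1)).charmatrix.adjugate j k =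
      X.charmatrix.adjugate j k := by
  rw [charmatrix_updateRow_add_smul_single, Matrix.adjugate_apply, Matrix.adjugate_apply,
    Matrix.updateRow_idem]

/-! ### Change of variables along the roots of a pencil `a - m b` -/

theorem Multiset.sum_map_eq_sum_toFinset {α M : Type*} [DecidableEq α] [AddCommMonoid M]
    (s : Multiset α) (f : α → M) (h : ∀ a ∈ s, s.count a ≠ 1 → f a = 0) :
    (s.map f).sum = ∑ a ∈ s.toFinset, f a := by
  rw [Finset.sum_multiset_map_count]
  refine Finset.sum_congr rfl fun a ha => ?_
  by_cases h1 : s.count a = 1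
  · rw [h1, one_smul]
  · rw [h a (Multiset.mem_toFinset.1 ha) h1, smul_zero]

theorem Polynomial.count_roots_eq_one {R : Type*} [CommRing R] [IsDomain R] [DecidableEq R]
    {p : Polynomial R} {z : R} (hz : z ∈ p.roots) (h : p.derivative.eval z ≠ 0) :
    p.roots.count z = 1 := by
  have hp := (Polynomial.mem_roots'.1 hz).1
  have hr := (Polynomial.mem_roots'.1 hz).2
  rw [Polynomial.count_roots]
  have h1 : 0 < p.rootMultiplicity z := (Polynomial.rootMultiplicity_pos hp).2 hr
  have h2 : ¬ 1 < p.rootMultiplicity z := fun h2 =>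
    h ((Polynomial.one_lt_rootMultiplicity_iff_isRoot hp).1 h2).2
  omega

/-- A holomorphic function with nonvanishing derivative on a set is injective on the members of a
countable measurable partition of this set. -/
theorem exists_measurable_partition_injOn {f f' : ℂ → ℂ} {D : Set ℂ} (hD : MeasurableSet D)
    (hf : ∀ z ∈ D, HasStrictDerivAt f (f' z) z) (hf' : ∀ z ∈ D, f' z ≠ 0) :
    ∃ S : ℕ → Set ℂ, (∀ i, MeasurableSet (S i)) ∧ Pairwise (Function.onFun Disjoint S) ∧
      ⋃ i, S i = D ∧ ∀ i, Set.InjOn f (S i) := by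
  have hloc : ∀ z ∈ D, ∃ t : Set ℂ, IsOpen t ∧ z ∈ t ∧ Set.InjOn f t := by
    intro z hz
    have h := (hf z hz).hasStrictFDerivAt_equiv (hf' z hz)
    exact ⟨(h.toOpenPartialHomeomorph f).source, (h.toOpenPartialHomeomorph f).open_source,
      h.mem_toOpenPartialHomeomorph_source,
      (h.toOpenPartialHomeomorph f).injOn⟩
  choose! t ht hzt hinj using hloc
  -- Lindelöf: countably many of the neighbourhoods from the inverse function theorem cover `D`.
  obtain ⟨s, hsD, hsc, hs⟩ := TopologicalSpace.countable_cover_nhdsWithin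
    (f := t) (s := D) fun z hz => mem_nhdsWithin_of_mem_nhds ((ht z hz).mem_nhds (hzt z hz))
  rcases s.eq_empty_or_nonempty with rfl | hne
  · refine ⟨fun _ => ∅, fun _ => MeasurableSet.empty, fun i j _ => by simp [Function.onFun], ?_,
      fun _ => by simp⟩
    have : D = ∅ := by simpa [Set.subset_empty_iff] using hs
    simp [this]
  · obtain ⟨e, he⟩ := hsc.exists_eq_range hne
    have heD : ∀ i, e i ∈ D := fun i => hsD (he ▸ Set.mem_range_self i)
    refine ⟨fun i => D ∩ disjointed (fun i => t (e i)) i, fun i => ?_, fun i j hij => ?_, ?_,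
      fun i => ?_⟩
    · exact hD.inter (MeasurableSet.disjointed (fun i => (ht _ (heD i)).measurableSet) i)
    · exact ((disjoint_disjointed _) hij).mono Set.inter_subset_right Set.inter_subset_right
    · rw [← Set.inter_iUnion, iUnion_disjointed, Set.inter_eq_left]
      rw [he, Set.biUnion_range] at hs
      exact hs
    · exact (hinj _ (heD i)).mono (Set.inter_subset_right.trans (disjointed_subset _ _))

/-- Multiplication by `c` on `ℂ = ℝ²` has real determinant `|c|²`. The extension by zero sends `m`
to the value of `g` at its only preimage in `S`, if there is one. -/
theorem lintegral_extend_eq_setLIntegral {f f' : ℂ → ℂ} {S : Set ℂ} (hS : MeasurableSet S)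
    (hf : ∀ z ∈ S, HasDerivAt f (f' z) z) (hinj : Set.InjOn f S) {g : ℂ → ℝ≥0∞}
    (hg : Measurable g) :
    Measurable (Function.extend (fun z : S => f z) (fun z : S => g z) 0) ∧
    ∫⁻ m, Function.extend (fun z : S => f z) (fun z : S => g z) 0 m =
      ∫⁻ z in S, ‖f' z‖ₑ ^ 2 * g z := by
  have hfd : ∀ z ∈ S, HasFDerivWithinAt f
      ((ContinuousLinearMap.toSpanSingleton ℂ (f' z)).restrictScalars ℝ) S z := fun z hz =>
    ((hf z hz).hasFDerivAt.restrictScalars ℝ).hasFDerivWithinAt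
  have hemb : MeasurableEmbedding (fun z : S => f z) :=
    measurableEmbedding_of_fderivWithin hS hfd hinj
  have hi : Function.Injective (fun z : S => f z) := hinj.injective
  have hext : ∀ z ∈ S, Function.extend (fun z : S => f z) (fun z : S => g z) 0 (f z) = g z :=
    fun z hz => hi.extend_apply (fun z : S => g z) 0 ⟨z, hz⟩
  refine ⟨hemb.measurable_extend (hg.comp measurable_subtype_coe) measurable_const, ?_⟩
  have him : MeasurableSet (f '' S) := by
    have := hemb.measurableSet_range
    rwa [Set.image_eq_range]
  have hdet : ∀ c : ℂ, ENNReal.ofReal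
      |((ContinuousLinearMap.toSpanSingleton ℂ c).restrictScalars ℝ).det| = ‖c‖ₑ ^ 2 := by
    intro c
    have : ((ContinuousLinearMap.toSpanSingleton ℂ c).restrictScalars ℝ).det = ‖c‖ ^ 2 := by
      simp [ContinuousLinearMap.det, LinearMap.det_restrictScalars, Algebra.norm_complex_apply,
        Complex.normSq_eq_norm_sq]
    rw [this, abs_of_nonneg (by positivity), ENNReal.ofReal_pow (norm_nonneg _), ofReal_norm]
  rw [← lintegral_add_compl _ him, lintegral_image_eq_lintegral_abs_det_fderiv_mul volume hS hfd
    hinj]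
  have h0 : ∫⁻ m in (f '' S)ᶜ, Function.extend (fun z : S => f z) (fun z : S => g z) 0 m = 0 := by
    rw [setLIntegral_congr_fun him.compl (g := fun _ => 0), lintegral_zero]
    intro m hm
    refine Function.extend_apply' _ _ _ fun ⟨z, hz⟩ => hm ⟨z, z.2, hz⟩
  rw [h0, add_zero]
  refine setLIntegral_congr_fun hS fun z hz => ?_
  simp only [hdet, hext z hz]

-- With `f = a/b`, a root `z` at parameter `m` with `b(z) ≠ 0` satisfies `f z = m`, and the summand
-- is `1/|f' z|²`. Integrated over `m`, the Jacobian cancels the weight and leaves the area of the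
-- part of `B` that is reached.
open Polynomial in
theorem lintegral_sum_roots_sub_C_mul_le (a b : ℂ[X]) {B : Set ℂ} (hB : MeasurableSet B) :
    ∫⁻ m, ((a - C m * b).roots.map (B.indicator fun z =>
      ‖b.eval z / (a - C m * b).derivative.eval z‖ₑ ^ 2)).sum ≤ volume B := by
  classical
  set c : ℂ[X] := a.derivative * b - a * b.derivative with hc
  let f : ℂ → ℂ := fun z => a.eval z / b.eval z
  let f' : ℂ → ℂ := fun z => c.eval z / b.eval z ^ 2
  let D : Set ℂ := {z | z ∈ B ∧ b.eval z ≠ 0 ∧ c.eval z ≠ 0}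
  have hD : MeasurableSet D := hB.inter
    (((isOpen_ne_fun b.continuous continuous_const).inter
      (isOpen_ne_fun c.continuous continuous_const)).measurableSet)
  have hf : ∀ z ∈ D, HasStrictDerivAt f (f' z) z := by
    intro z hz
    have := (a.hasStrictDerivAt z).div (b.hasStrictDerivAt z) hz.2.1
    simp only [f', hc, Polynomial.eval_sub, Polynomial.eval_mul]
    exact this
  have hf' : ∀ z ∈ D, f' z ≠ 0 := fun z hz => div_ne_zero hz.2.2 (pow_ne_zero 2 hz.2.1)
  obtain ⟨S, hS, hdisj, hSD, hinj⟩ := exists_measurable_partition_injOn hD hf hf'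
  have hSi : ∀ i, S i ⊆ D := fun i => hSD ▸ Set.subset_iUnion S i
  -- The inverse Jacobian, chosen so that each piece `S i` integrates to its volume.
  let g : ℂ → ℝ≥0∞ := fun z => (‖f' z‖ₑ ^ 2)⁻¹
  have hg : Measurable g := by
    have : Measurable f' := c.continuous.measurable.div (b.continuous.measurable.pow_const 2)
    fun_prop
  have key := fun i => lintegral_extend_eq_setLIntegral (hS i)
    (fun z hz => (hf z (hSi i hz)).hasDerivAt) (hinj i) hg
  let T : ℕ → ℂ → ℝ≥0∞ := fun i =>
    Function.extend (fun z : S i => f z) (fun z : S i => g z) 0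
  have hT : ∀ i, ∫⁻ m, T i m = volume (S i) := by
    intro i
    rw [(key i).2, ← setLIntegral_one]
    refine setLIntegral_congr_fun (hS i) fun z hz => ?_
    exact ENNReal.mul_inv_cancel (by simpa using hf' z (hSi i hz)) (by simp)
  have hpt : ∀ m, ((a - C m * b).roots.map (B.indicator fun z =>
      ‖b.eval z / (a - C m * b).derivative.eval z‖ₑ ^ 2)).sum ≤ ∑' i, T i m := by
    intro m
    set p := a - C m * b with hp
    set h : ℂ → ℝ≥0∞ := B.indicator fun z => ‖b.eval z / p.derivative.eval z‖ₑ ^ 2 with hh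
    have hne : ∀ z, h z ≠ 0 → z ∈ B ∧ b.eval z ≠ 0 ∧ p.derivative.eval z ≠ 0 := by
      intro z hz
      have hzB : z ∈ B := Set.mem_of_indicator_ne_zero hz
      rw [hh, Set.indicator_of_mem hzB] at hz
      refine ⟨hzB, fun h0 => hz (by simp [h0]), fun h0 => hz (by simp [h0])⟩
    -- At a multiple root `p'` vanishes, and division by zero makes the summand `0`; multiplicities
    -- therefore play no role.
    rw [Multiset.sum_map_eq_sum_toFinset _ _ fun z hz hcount => by
      by_contra h0
      exact hcount (Polynomial.count_roots_eq_one hz (hne z h0).2.2)]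
    have hroot : ∀ z ∈ p.roots.toFinset, h z ≠ 0 → z ∈ D ∧ f z = m ∧ g z = h z := by
      intro z hz h0
      obtain ⟨hzB, hb, hpd⟩ := hne z h0
      have hr : a.eval z = m * b.eval z := by
        have := (Polynomial.mem_roots'.1 (Multiset.mem_toFinset.1 hz)).2
        simpa [hp, Polynomial.IsRoot, sub_eq_zero] using this
      -- Substituting `a = m b` at the root gives `a' b - a b' = (a' - m b') b`.
      have hcz : c.eval z = p.derivative.eval z * b.eval z := by
        simp [hc, hp, hr]; ring
      refine ⟨⟨hzB, hb, hcz ▸ mul_ne_zero hpd hb⟩, by simp [f, hr, hb], ?_⟩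
      have : f' z = (b.eval z / p.derivative.eval z)⁻¹ := by
        simp only [f', hcz]; field_simp
      simp only [g, this, hh, Set.indicator_of_mem hzB]
      rw [enorm_inv (div_ne_zero hb hpd), ENNReal.inv_pow, inv_inv]
    have hsplit : ∀ z ∈ p.roots.toFinset, h z = ∑' i, (S i).indicator h z := by
      intro z hz
      by_cases h0 : h z = 0
      · have : ∀ i, (S i).indicator h z = 0 := fun i => by
          by_cases hi : z ∈ S i <;> simp [hi, h0]
        simp [this, h0]
      · have hzD := (hroot z hz h0).1
        rw [← hSD, Set.mem_iUnion] at hzD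
        obtain ⟨i, hi⟩ := hzD
        rw [tsum_eq_single i, Set.indicator_of_mem hi]
        intro j hj
        exact Set.indicator_of_notMem (fun hj' => (Set.disjoint_left.1 (hdisj hj) hj') hi) _
    rw [Finset.sum_congr rfl hsplit, ← Summable.tsum_finsetSum fun _ _ => ENNReal.summable]
    refine ENNReal.tsum_le_tsum fun i => ?_
    by_cases hall : ∀ z ∈ p.roots.toFinset, (S i).indicator h z = 0
    · rw [Finset.sum_eq_zero hall]; exact zero_le
    · push Not at hall
      obtain ⟨z, hz, hz0⟩ := hall
      have hzS : z ∈ S i := Set.mem_of_indicator_ne_zero hz0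
      rw [Set.indicator_of_mem hzS] at hz0
      obtain ⟨-, hfz, hgz⟩ := hroot z hz hz0
      have hTz : T i m = h z := by
        rw [← hgz, ← hfz]
        exact (hinj i).injective.extend_apply (fun z : S i => g z) 0 ⟨z, hzS⟩
      rw [hTz, Finset.sum_eq_single_of_mem z hz, Set.indicator_of_mem hzS]
      intro w hw hwz
      by_contra hw0
      have hwS : w ∈ S i := Set.mem_of_indicator_ne_zero hw0
      rw [Set.indicator_of_mem hwS] at hw0
      exact hwz (hinj i hwS hzS ((hroot w hw hw0).2.1.trans hfz.symm))
  calc _ ≤ ∫⁻ m, ∑' i, T i m := lintegral_mono hpt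
    _ = ∑' i, volume (S i) := by
      rw [lintegral_tsum fun i => (key i).1.aemeasurable]
      exact tsum_congr hT
    _ = volume D := by rw [← hSD, measure_iUnion hdisj hS]
    _ ≤ volume B := measure_mono fun z hz => hz.1

/-! ### Continuity of roots and semicontinuity of sums over them -/

section

open Polynomial Topology

/-- `|p(z)|` is the product of the distances from `z` to the roots; take the nearest root. -/
theorem Polynomial.exists_root_dist_pow_le {p : ℂ[X]} (hp : p.Monic) (h0 : p.natDegree ≠ 0)
    (z : ℂ) : ∃ w ∈ p.roots, ‖z - w‖ ^ p.natDegree ≤ ‖p.eval z‖ := by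
  have hs : p.Splits := IsAlgClosed.splits p
  have hcard : p.roots.card = p.natDegree := hs.natDegree_eq_card_roots.symm
  have hne : p.roots ≠ 0 := fun h => h0 (by rw [← hcard, h, Multiset.card_zero])
  obtain ⟨w, hw, hmin⟩ := Finset.exists_min_image p.roots.toFinset (fun w => ‖z - w‖)
    (by rwa [Multiset.toFinset_nonempty])
  refine ⟨w, Multiset.mem_toFinset.1 hw, ?_⟩
  calc ‖z - w‖ ^ p.natDegree = (p.roots.map fun _ => ‖z - w‖).prod := by
        rw [Multiset.map_const', Multiset.prod_replicate, hcard]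
    _ ≤ (p.roots.map fun x => ‖z - x‖).prod :=
        Multiset.prod_map_le_prod_map₀ _ _ (fun _ _ => norm_nonneg _)
          fun x hx => hmin x (Multiset.mem_toFinset.2 hx)
    _ = ‖p.eval z‖ := by
        rw [hs.eval_eq_prod_roots_of_monic hp, ← normHom_apply, map_multiset_prod,
          Multiset.map_map]
        rfl

/-- Near each root `z` of `p x₀`, `p x` has a root within `|p x (z)|^{1/n}`, which tends to `0`.
Distinct limits keep the `n` chosen roots distinct nearby, so by counting they are all the roots. -/
theorem exists_continuousAt_roots {E : Type*} [TopologicalSpace E] {p : E → ℂ[X]} {n : ℕ}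
    (hm : ∀ x, (p x).Monic) (hn : ∀ x, (p x).natDegree = n)
    (hc : ∀ z, Continuous fun x => (p x).eval z) {x₀ : E} (h : (p x₀).roots.Nodup) :
    ∃ r : ℂ → E → ℂ, (∀ z ∈ (p x₀).roots, ContinuousAt (r z) x₀ ∧ r z x₀ = z) ∧
      ∀ᶠ x in 𝓝 x₀, (p x).roots.Nodup ∧ (p x).roots = (p x₀).roots.map fun z => r z x := by
  have hcard : ∀ x, (p x).roots.card = n := fun x => by
    rw [← (IsAlgClosed.splits (p x)).natDegree_eq_card_roots, hn]
  rcases eq_or_ne n 0 with rfl | hn0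
  · have : ∀ x, (p x).roots = 0 := fun x => Multiset.card_eq_zero.1 (hcard x)
    exact ⟨fun z _ => z, by simp [this], by simp [this]⟩
  choose r hr hrle using fun z x =>
    Polynomial.exists_root_dist_pow_le (hm x) ((hn x).symm ▸ hn0) z
  simp only [hn] at hrle
  have hr0 : ∀ z ∈ (p x₀).roots, r z x₀ = z := by
    intro z hz
    have h1 := hrle z x₀
    rw [(Polynomial.mem_roots'.1 hz).2, norm_zero] at h1
    have h2 := pow_eq_zero_iff hn0 |>.1 (h1.antisymm (by positivity))
    exact (sub_eq_zero.1 (norm_eq_zero.1 h2)).symm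
  have hrc : ∀ z ∈ (p x₀).roots, ContinuousAt (r z) x₀ := by
    intro z hz
    rw [ContinuousAt, hr0 z hz, tendsto_iff_norm_sub_tendsto_zero]
    have h1 : Filter.Tendsto (fun x => ‖(p x).eval z‖ ^ ((n : ℝ)⁻¹)) (𝓝 x₀) (𝓝 0) := by
      have h2 : ContinuousAt (fun x => ‖(p x).eval z‖ ^ ((n : ℝ)⁻¹)) x₀ :=
        ((hc z).norm.rpow_const fun _ => Or.inr (by positivity)).continuousAt
      have h3 : ‖(p x₀).eval z‖ ^ ((n : ℝ)⁻¹) = 0 := by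
        rw [(Polynomial.mem_roots'.1 hz).2, norm_zero, Real.zero_rpow (by positivity)]
      rw [ContinuousAt, h3] at h2
      exact h2
    refine squeeze_zero (fun _ => norm_nonneg _) (fun x => ?_) h1
    rw [norm_sub_rev]
    calc ‖z - r z x‖ = (‖z - r z x‖ ^ n) ^ ((n : ℝ)⁻¹) :=
          (Real.pow_rpow_inv_natCast (norm_nonneg _) hn0).symm
      _ ≤ _ := Real.rpow_le_rpow (by positivity) (hrle z x) (by positivity)
  refine ⟨r, fun z hz => ⟨hrc z hz, hr0 z hz⟩, ?_⟩
  have hinj : ∀ᶠ x in 𝓝 x₀, ∀ z ∈ (p x₀).roots.toFinset, ∀ w ∈ (p x₀).roots.toFinset,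
      z ≠ w → r z x ≠ r w x := by
    rw [Filter.eventually_all_finset]
    intro z hz
    rw [Filter.eventually_all_finset]
    intro w hw
    refine Filter.eventually_imp_distrib_left.2 fun hzw => ?_
    rw [Multiset.mem_toFinset] at hz hw
    have hne : r z x₀ ≠ r w x₀ := by rwa [hr0 z hz, hr0 w hw]
    exact ((hrc z hz).prodMk (hrc w hw)).preimage_mem_nhds
      ((isOpen_ne_fun continuous_fst continuous_snd).mem_nhds hne)
  filter_upwards [hinj] with x hx
  have hnd : ((p x₀).roots.map fun z => r z x).Nodup := by
    refine Multiset.Nodup.map_on (fun z hz w hw hzw => ?_) h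
    by_contra hne
    exact hx z (Multiset.mem_toFinset.2 hz) w (Multiset.mem_toFinset.2 hw) hne hzw
  have heq : ((p x₀).roots.map fun z => r z x) = (p x).roots := by
    refine Multiset.eq_of_le_of_card_le ((Multiset.le_iff_subset hnd).2 fun w hw => ?_) ?_
    · obtain ⟨z, -, rfl⟩ := Multiset.mem_map.1 hw
      exact hr z x
    · rw [Multiset.card_map, hcard, hcard]
  exact ⟨heq ▸ hnd, heq.symm⟩

/-- Where the roots are simple, the sum is locally a finite sum along root selections continuous at
the point. Elsewhere the function is `0`, the least value, so there is nothing to check. -/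
theorem lowerSemicontinuous_indicator_sum_roots {E : Type*} [TopologicalSpace E] {p : E → ℂ[X]}
    {n : ℕ} (hm : ∀ x, (p x).Monic) (hn : ∀ x, (p x).natDegree = n)
    (hc : ∀ z, Continuous fun x => (p x).eval z) {G : E → ℂ → ℝ≥0∞}
    (hG : ∀ x, (p x).roots.Nodup → ∀ z ∈ (p x).roots,
      LowerSemicontinuousAt (Function.uncurry G) (x, z)) :
    LowerSemicontinuous
      ({x | (p x).roots.Nodup}.indicator fun x => ((p x).roots.map (G x)).sum) := by
  intro x₀
  by_cases h : (p x₀).roots.Nodup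
  · obtain ⟨r, hr, hev⟩ := exists_continuousAt_roots hm hn hc h
    have hsum : LowerSemicontinuousAt (fun x => ∑ z ∈ (p x₀).roots.toFinset, G x (r z x)) x₀ := by
      refine lowerSemicontinuousAt_sum fun z hz => ?_
      obtain ⟨h1, h2⟩ := hr z (Multiset.mem_toFinset.1 hz)
      refine LowerSemicontinuousAt.comp (f := Function.uncurry G) (g := fun x => (x, r z x)) ?_
        (continuousAt_id.prodMk h1)
      rw [h2]
      exact hG x₀ h z (Multiset.mem_toFinset.1 hz)
    have heq : ∀ᶠ x in 𝓝 x₀, {x | (p x).roots.Nodup}.indicator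
        (fun x => ((p x).roots.map (G x)).sum) x =
          ∑ z ∈ (p x₀).roots.toFinset, G x (r z x) := by
      filter_upwards [hev] with x hx
      rw [Set.indicator_of_mem (by exact hx.1), hx.2, Multiset.map_map, Finset.sum,
        Multiset.toFinset_val, h.dedup]
      rfl
    intro c hcx
    rw [heq.self_of_nhds] at hcx
    filter_upwards [hsum c hcx, heq] with x h1 h2
    rwa [h2]
  · intro c hcx
    rw [Set.indicator_of_notMem (by exact h)] at hcx
    exact absurd hcx not_lt_zero

theorem Polynomial.eval_derivative_ne_zero_of_nodup_roots {R : Type*} [CommRing R] [IsDomain R]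
    {p : R[X]} (h : p.roots.Nodup) {z : R} (hz : z ∈ p.roots) : p.derivative.eval z ≠ 0 := by
  classical
  intro h0
  have hp := (Polynomial.mem_roots'.1 hz).1
  have h1 := (Polynomial.one_lt_rootMultiplicity_iff_isRoot hp).2
    ⟨(Polynomial.mem_roots'.1 hz).2, h0⟩
  rw [← Polynomial.count_roots] at h1
  exact absurd (Multiset.nodup_iff_count_le_one.1 h z) (by omega)

theorem lowerSemicontinuousAt_indicator_enorm_div_sq {E : Type*} [TopologicalSpace E]
    {b q : E → ℂ → ℂ} (hb : Continuous (Function.uncurry b)) (hq : Continuous (Function.uncurry q))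
    {B : Set ℂ} (hB : IsOpen B) {x : E} {z : ℂ} (h : q x z ≠ 0) :
    LowerSemicontinuousAt
      (Function.uncurry fun x => B.indicator fun z => ‖b x z / q x z‖ₑ ^ 2) (x, z) := by
  by_cases hz : z ∈ B
  · have hcont : ContinuousAt (fun y : E × ℂ => ‖b y.1 y.2 / q y.1 y.2‖ₑ ^ 2) (x, z) :=
      (ENNReal.continuous_pow 2).continuousAt.comp
        (ContinuousAt.div (f := Function.uncurry b) (g := Function.uncurry q)
          hb.continuousAt hq.continuousAt (by exact h)).enorm
    have hev : ∀ᶠ y : E × ℂ in 𝓝 (x, z), y.2 ∈ B :=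
      continuousAt_snd.eventually (hB.mem_nhds hz)
    intro c hc
    simp only [Function.uncurry, Set.indicator_of_mem hz] at hc
    filter_upwards [hev, hcont.lowerSemicontinuousAt c hc] with y h1 h2
    simpa only [Function.uncurry, Set.indicator_of_mem h1] using h2
  · intro c hc
    simp only [Function.uncurry, Set.indicator_of_notMem hz] at hc
    exact absurd hc not_lt_zero

theorem continuous_eval_of_continuous_coeff {E : Type*} [TopologicalSpace E] {p : E → ℂ[X]} {n : ℕ}
    (hn : ∀ x, (p x).natDegree < n) (hp : ∀ i, Continuous fun x => (p x).coeff i) :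
    Continuous fun y : E × ℂ => (p y.1).eval y.2 := by
  have : (fun y : E × ℂ => (p y.1).eval y.2) =
      fun y => ∑ i ∈ Finset.range n, (p y.1).coeff i * y.2 ^ i := by
    ext y; exact Polynomial.eval_eq_sum_range' (hn y.1) y.2
  rw [this]
  exact continuous_finsetSum _ fun i _ =>
    ((hp i).comp continuous_fst).mul (continuous_snd.pow i)

end

/-! ### Condition numbers through the adjugate -/

theorem exists_isSpectralExpansion {n : ℕ} {M : Matrix (Fin n) (Fin n) ℂ}
    (h : M.charpoly.roots.Nodup) : ∃ V d, IsSpectralExpansion M V d ∧ Function.Injective d ∧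
      M.charpoly.roots = Finset.univ.val.map d := by
  classical
  have hcard : M.charpoly.roots.toFinset.card = n := by
    rw [Multiset.toFinset_card_of_nodup h,
      ← (IsAlgClosed.splits M.charpoly).natDegree_eq_card_roots]
    simp
  let e := M.charpoly.roots.toFinset.equivFinOfCardEq hcard
  let d : Fin n → ℂ := fun i => e.symm i
  have hd : Function.Injective d := Subtype.val_injective.comp e.symm.injective
  have hdr : ∀ i, d i ∈ M.charpoly.roots := fun i => Multiset.mem_toFinset.1 (e.symm i).2
  have hv : ∀ i, ∃ v, Module.End.HasEigenvector M.toLin' (d i) v := by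
    intro i
    refine Module.End.HasEigenvalue.exists_hasEigenvector ?_
    rw [Module.End.hasEigenvalue_iff_mem_spectrum, Matrix.spectrum_toLin',
      Matrix.mem_spectrum_iff_isRoot_charpoly]
    exact (Polynomial.mem_roots'.1 (hdr i)).2
  choose v hv using hv
  have hli := Module.End.eigenvectors_linearIndependent' M.toLin' d hd v hv
  let V : Matrix (Fin n) (Fin n) ℂ := (Matrix.of v).transpose
  have hV : IsUnit V := Matrix.linearIndependent_cols_iff_isUnit.1 hli
  have hVd : IsUnit V.det := (Matrix.isUnit_iff_isUnit_det V).1 hV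
  have hMV : M * V = V * Matrix.diagonal d := by
    ext j i
    have := congrFun (hv i).apply_eq_smul j
    rw [Matrix.toLin'_apply] at this
    rw [Matrix.mul_diagonal]
    simpa [V, Matrix.mul_apply, Matrix.mulVec, dotProduct, mul_comm] using this
  refine ⟨V, d, ⟨hVd, ?_⟩, hd, ?_⟩
  · rw [← hMV, Matrix.mul_assoc, Matrix.mul_nonsing_inv _ hVd, Matrix.mul_one]
  · symm
    refine Multiset.eq_of_le_of_card_le ((Multiset.le_iff_subset
      (Multiset.Nodup.map hd Finset.univ.nodup)).2 fun z hz => ?_) ?_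
    · obtain ⟨i, -, rfl⟩ := Multiset.mem_map.1 hz
      exact hdr i
    · rw [← Multiset.toFinset_card_of_nodup h, hcard]
      simp

theorem eval_adjugate_charmatrix {n : Type*} [Fintype n] [DecidableEq n] {R : Type*} [CommRing R]
    (M : Matrix n n R) (z : R) (j k : n) :
    (M.charmatrix.adjugate j k).eval z = (Matrix.scalar n z - M).adjugate j k := by
  have h1 : (Polynomial.evalRingHom z).mapMatrix M.charmatrix = Matrix.scalar n z - M := by
    ext i l
    simp only [RingHom.mapMatrix_apply, Matrix.map_apply, Matrix.charmatrix_apply, Matrix.sub_apply,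
      Matrix.scalar_apply, Matrix.diagonal_apply]
    split_ifs <;> simp
  rw [← h1, ← RingHom.map_adjugate]
  rfl

theorem IsSpectralExpansion.charpoly_eq {n : ℕ} {M V : Matrix (Fin n) (Fin n) ℂ} {d : Fin n → ℂ}
    (h : IsSpectralExpansion M V d) :
    M.charpoly = ∏ i, (Polynomial.X - Polynomial.C (d i)) := by
  obtain ⟨U, hU⟩ := (Matrix.isUnit_iff_isUnit_det V).2 h.isUnit_det
  have h1 := Matrix.charpoly_units_conj U (Matrix.diagonal d)
  rw [hU, ← h.eq, Matrix.charpoly_diagonal] at h1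
  exact h1

theorem IsSpectralExpansion.eval_derivative_charpoly {n : ℕ} {M V : Matrix (Fin n) (Fin n) ℂ}
    {d : Fin n → ℂ} (h : IsSpectralExpansion M V d) (i : Fin n) :
    M.charpoly.derivative.eval (d i) = ∏ l ∈ Finset.univ.erase i, (d i - d l) := by
  rw [h.charpoly_eq, Polynomial.derivative_prod_finset, Polynomial.eval_finsetSum,
    Finset.sum_eq_single_of_mem i (Finset.mem_univ i)]
  · simp [Polynomial.eval_prod]
  · intro l _ hl
    rw [Polynomial.eval_mul, Polynomial.eval_prod,
      Finset.prod_eq_zero (Finset.mem_erase.2 ⟨hl.symm, Finset.mem_univ i⟩) (by simp), zero_mul]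

/-- The adjugate reverses products, so it is conjugated by `V` along with `M`. The diagonal factor
has a zero at position `i`, so its adjugate is supported at `(i, i)`, with value `∏ (d i - d l)`
over `l ≠ i`, which is the derivative of the characteristic polynomial. -/
theorem IsSpectralExpansion.eval_adjugate_charmatrix {n : ℕ} {M V : Matrix (Fin n) (Fin n) ℂ}
    {d : Fin n → ℂ} (h : IsSpectralExpansion M V d) (i j k : Fin n) :
    (M.charmatrix.adjugate j k).eval (d i) =
      V j i * V⁻¹ i k * M.charpoly.derivative.eval (d i) := by
  have hV := h.isUnit_det
  have hM : Matrix.scalar (Fin n) (d i) - M =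
      V * Matrix.diagonal (fun l => d i - d l) * V⁻¹ := by
    have h1 : Matrix.diagonal (fun l => d i - d l) =
        Matrix.scalar (Fin n) (d i) - Matrix.diagonal d := by
      rw [Matrix.scalar_apply, Matrix.diagonal_sub]
    have h2 : V * Matrix.scalar (Fin n) (d i) * V⁻¹ = Matrix.scalar (Fin n) (d i) := by
      rw [← (Matrix.scalar_commute (d i) (fun _ => Commute.all _ _) V).eq, Matrix.mul_assoc,
        Matrix.mul_nonsing_inv _ hV, Matrix.mul_one]
    rw [h1, Matrix.mul_sub, Matrix.sub_mul, h2, ← h.eq]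
  have hadj : V.adjugate = V.det • V⁻¹ := by
    rw [Matrix.inv_def, smul_smul, Ring.mul_inverse_cancel _ hV, one_smul]
  have hadj' : V⁻¹.adjugate = V.det⁻¹ • V := by
    have h1 : V⁻¹.adjugate = V⁻¹.det • V⁻¹⁻¹ := by
      have hVi : IsUnit V⁻¹.det := Matrix.isUnit_nonsing_inv_det V hV
      rw [Matrix.inv_def V⁻¹, smul_smul, Ring.mul_inverse_cancel _ hVi, one_smul]
    rw [h1, Matrix.nonsing_inv_nonsing_inv _ hV, Matrix.det_nonsing_inv, Ring.inverse_eq_inv']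
  have h3 : (Matrix.scalar (Fin n) (d i) - M).adjugate =
      V * Matrix.diagonal (fun l => ∏ m ∈ Finset.univ.erase l, (d i - d m)) * V⁻¹ := by
    rw [hM, Matrix.adjugate_mul_distrib, Matrix.adjugate_mul_distrib, hadj, hadj',
      Matrix.adjugate_diagonal, Matrix.mul_smul, Matrix.smul_mul, Matrix.mul_smul, smul_smul,
      inv_mul_cancel₀ hV.ne_zero, one_smul, Matrix.mul_assoc]
  rw [_root_.eval_adjugate_charmatrix, h3, h.eval_derivative_charpoly, Matrix.mul_apply,
    Finset.sum_eq_single_of_mem i (Finset.mem_univ i), Matrix.mul_diagonal]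
  · ring
  · intro l _ hl
    rw [Matrix.mul_diagonal,
      Finset.prod_eq_zero (Finset.mem_erase.2 ⟨hl.symm, Finset.mem_univ i⟩) (sub_self _), mul_zero,
      zero_mul]

theorem EuclideanSpace.enorm_sq_eq {𝕜 ι : Type*} [RCLike 𝕜] [Fintype ι] (x : EuclideanSpace 𝕜 ι) :
    ‖x‖ₑ ^ 2 = ∑ i, ‖x i‖ₑ ^ 2 := by
  rw [← ofReal_norm, ← ENNReal.ofReal_pow (norm_nonneg _), EuclideanSpace.norm_sq_eq,
    ENNReal.ofReal_sum_of_nonneg fun _ _ => by positivity]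
  simp only [ENNReal.ofReal_pow (norm_nonneg _), ofReal_norm]

theorem sumSqEigenvalueCond_eq {n : ℕ} {M : Matrix (Fin n) (Fin n) ℂ}
    (h : M.charpoly.roots.Nodup) (B : Set ℂ) :
    sumSqEigenvalueCond M B = ∑ j, ∑ k, (M.charpoly.roots.map (B.indicator fun z =>
      ‖(M.charmatrix.adjugate j k).eval z / M.charpoly.derivative.eval z‖ₑ ^ 2)).sum := by
  obtain ⟨V, d, hVd, hd, hr⟩ := exists_isSpectralExpansion h
  have hdr : ∀ i, d i ∈ M.charpoly.roots := fun i => by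
    rw [hr]; exact Multiset.mem_map_of_mem d (Finset.mem_univ i)
  have hsum : ∀ f : ℂ → ℝ≥0∞, (M.charpoly.roots.map f).sum = ∑ i, f (d i) := fun f => by
    rw [hr, Multiset.map_map]; rfl
  rw [sumSqEigenvalueCond]
  simp only [hsum]
  rw [Finset.sum_congr rfl fun j _ => Finset.sum_comm, Finset.sum_comm]
  refine Finset.sum_congr rfl fun i _ => ?_
  by_cases hi : d i ∈ B
  · simp only [Set.indicator_of_mem hi]
    have hp := Polynomial.eval_derivative_ne_zero_of_nodup_roots h (hdr i)
    simp only [hVd.eval_adjugate_charmatrix, mul_div_cancel_right₀ _ hp, enorm_mul, mul_pow]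
    rw [eigenvalueCond_eq hVd hd i, mul_pow, EuclideanSpace.enorm_sq_eq,
      EuclideanSpace.enorm_sq_eq, Finset.sum_mul_sum]
  · simp only [Set.indicator_of_notMem hi, Finset.sum_const_zero]

/-! ### Almost sure simplicity of the spectrum -/

/-- Fubini and induction: for almost every choice of the other coordinates some coefficient in the
first variable survives, leaving finitely many roots, a null set for an atomless measure. -/
theorem MvPolynomial.ae_eval_ne_zero_fin {n : ℕ} (μ : Fin n → Measure ℂ) [∀ i, SigmaFinite (μ i)]
    [∀ i, NullSingletonClass (μ i)] {p : MvPolynomial (Fin n) ℂ} (hp : p ≠ 0) :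
    ∀ᵐ x ∂Measure.pi μ, MvPolynomial.eval x p ≠ 0 := by
  induction n with
  | zero =>
    refine Filter.Eventually.of_forall fun x hx => hp ?_
    rw [MvPolynomial.eq_C_of_isEmpty p] at hx ⊢
    rw [MvPolynomial.eval_C] at hx
    rw [hx, MvPolynomial.C_0]
  | succ n ih =>
    have hmp := Measure.measurePreserving_swap.comp (measurePreserving_piFinSuccAbove μ 0)
    have hq : MvPolynomial.finSuccEquiv ℂ n p ≠ 0 :=
      (map_ne_zero_iff _ (MvPolynomial.finSuccEquiv ℂ n).injective).2 hp
    obtain ⟨i, hi⟩ : ∃ i, (MvPolynomial.finSuccEquiv ℂ n p).coeff i ≠ 0 := by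
      by_contra! h
      exact hq (Polynomial.ext (by simpa using h))
    have key : ∀ᵐ q ∂(Measure.pi fun j => μ (Fin.succAbove 0 j)).prod (μ 0),
        MvPolynomial.eval (Fin.cons q.2 q.1 : Fin (n + 1) → ℂ) p ≠ 0 := by
      have hcont : Continuous fun q : (Fin n → ℂ) × ℂ =>
          MvPolynomial.eval (Fin.cons q.2 q.1 : Fin (n + 1) → ℂ) p := by
        refine (MvPolynomial.continuous_eval p).comp (continuous_pi fun j => ?_)
        refine Fin.cases ?_ (fun j => ?_) j
        · simpa using continuous_snd
        · simp only [Fin.cons_succ]; fun_prop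
      rw [Measure.ae_prod_iff_ae_ae (isOpen_ne_fun hcont continuous_const).measurableSet]
      filter_upwards [ih (fun j => μ (Fin.succAbove 0 j)) hi] with y hy
      have hne : (MvPolynomial.finSuccEquiv ℂ n p).map (MvPolynomial.eval y) ≠ 0 := fun h0 => hy (by
        rw [← Polynomial.coeff_map, h0, Polynomial.coeff_zero])
      have hfin := (Polynomial.finite_setOfPred_isRoot hne).measure_zero (μ 0)
      refine measure_mono_null (fun a ha => ?_) hfin
      simpa [MvPolynomial.eval_eq_eval_mv_eval'] using ha
    filter_upwards [hmp.quasiMeasurePreserving.ae key] with x hx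
    convert hx using 2
    congr 1
    refine (Fin.cons_self_tail x).symm

theorem MvPolynomial.ae_eval_ne_zero {σ : Type*} [Fintype σ] (μ : σ → Measure ℂ)
    [∀ i, SigmaFinite (μ i)] [∀ i, NullSingletonClass (μ i)] {p : MvPolynomial σ ℂ} (hp : p ≠ 0) :
    ∀ᵐ x ∂Measure.pi μ, MvPolynomial.eval x p ≠ 0 := by
  let e := Fintype.equivFin σ
  have hmp := (measurePreserving_piCongrLeft μ e.symm).symm
  have h := hmp.quasiMeasurePreserving.ae (MvPolynomial.ae_eval_ne_zero_fin (fun i => μ (e.symm i))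
    (p := MvPolynomial.rename e p)
    ((map_ne_zero_iff _ (MvPolynomial.rename_injective e e.injective)).2 hp))
  filter_upwards [h] with x hx
  rw [MvPolynomial.eval_rename] at hx
  convert hx using 2
  congr 1
  ext i
  simp [MeasurableEquiv.piCongrLeft, Equiv.piCongrLeft]

-- Fixing the formal degrees `n` and `n - 1` makes the resultant commute with specialisation of the
-- entries.
open Polynomial in
theorem nodup_roots_charpoly_iff {n : ℕ} (M : Matrix (Fin n) (Fin n) ℂ) :
    M.charpoly.roots.Nodup ↔ resultant M.charpoly M.charpoly.derivative n (n - 1) ≠ 0 := by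
  have h1 : M.charpoly.natDegree = n := by simp
  have h2 : M.charpoly.derivative.natDegree = n - 1 := by
    rw [natDegree_derivative, h1]
  have h3 := resultant_eq_zero_iff (f := M.charpoly) (g := M.charpoly.derivative)
  rw [h1, h2] at h3
  have hm := M.charpoly_monic.ne_zero
  rw [Polynomial.nodup_roots_iff_of_splits hm (IsAlgClosed.splits _), Polynomial.separable_def,
    Ne, h3]
  simp [hm]

open Polynomial in
theorem ae_nodup_roots_charpoly {n : ℕ} (μ : Fin n × Fin n → Measure ℂ)
    [∀ i, SigmaFinite (μ i)] [∀ i, NullSingletonClass (μ i)] :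
    ∀ᵐ x ∂Measure.pi μ, (Matrix.of (Function.curry x)).charpoly.roots.Nodup := by
  let U := Matrix.charpoly.univ ℂ (Fin n)
  let D : MvPolynomial (Fin n × Fin n) ℂ := resultant U U.derivative n (n - 1)
  have heval : ∀ x, MvPolynomial.eval x D = resultant (Matrix.of (Function.curry x)).charpoly
      (Matrix.of (Function.curry x)).charpoly.derivative n (n - 1) := by
    intro x
    rw [← Matrix.charpoly.univ_map_eval₂Hom (Fin n) (RingHom.id ℂ) x, Polynomial.derivative_map,
      Polynomial.resultant_map_map]
    rfl
  have hD : D ≠ 0 := by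
    intro h0
    -- The matrix `diag(0, …, n-1)` has simple spectrum and so witnesses that the discriminant is
    -- not the zero polynomial.
    let d : Fin n → ℂ := fun i => (i : ℂ)
    have hd : Function.Injective d := fun i j h => Fin.ext (by simpa [d] using h)
    let x : Fin n × Fin n → ℂ := fun q => Matrix.diagonal d q.1 q.2
    have hx : Matrix.of (Function.curry x) = Matrix.diagonal d := rfl
    have h1 := heval x
    rw [h0, map_zero] at h1
    refine (nodup_roots_charpoly_iff (Matrix.of (Function.curry x))).1 ?_ h1.symm
    rw [hx, Matrix.charpoly_diagonal, Polynomial.roots_prod _ _ (Finset.prod_ne_zero_iff.2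
      fun i _ => Polynomial.X_sub_C_ne_zero _)]
    simp only [Polynomial.roots_X_sub_C, Multiset.bind_singleton]
    exact Multiset.Nodup.map hd Finset.univ.nodup
  filter_upwards [MvPolynomial.ae_eval_ne_zero μ hD] with x hx
  rw [heval] at hx
  exact (nodup_roots_charpoly_iff _).2 hx

/-! ### Integration over the matrix entries -/

theorem continuous_coeff_charpoly_curry {m : Type*} [Fintype m] [DecidableEq m] (i : ℕ) :
    Continuous fun x : m × m → ℂ => (Matrix.of (Function.curry x)).charpoly.coeff i := by
  have : (fun x : m × m → ℂ => (Matrix.of (Function.curry x)).charpoly.coeff i) =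
      fun x => MvPolynomial.eval x ((Matrix.charpoly.univ ℂ m).coeff i) := by
    ext x
    exact (Matrix.charpoly.univ_coeff_eval₂Hom m (RingHom.id ℂ) x i).symm
  rw [this]
  exact MvPolynomial.continuous_eval _

theorem measurable_indicator_sum_roots_charpoly {n : ℕ} {B : Set ℂ} (hB : IsOpen B)
    (j k : Fin n) : Measurable
      ({x : Fin n × Fin n → ℂ | (Matrix.of (Function.curry x)).charpoly.roots.Nodup}.indicator
        fun x => ((Matrix.of (Function.curry x)).charpoly.roots.map (B.indicator fun z =>
          ‖((Matrix.of (Function.curry x)).charmatrix.adjugate j k).eval z /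
            (Matrix.of (Function.curry x)).charpoly.derivative.eval z‖ₑ ^ 2)).sum) := by
  have hnat : ∀ x : Fin n × Fin n → ℂ, (Matrix.of (Function.curry x)).charpoly.natDegree = n :=
    fun x => by simp
  have heval := continuous_eval_of_continuous_coeff (n := n + 1)
    (p := fun x : Fin n × Fin n → ℂ => (Matrix.of (Function.curry x)).charpoly)
    (fun x => by rw [hnat]; omega) continuous_coeff_charpoly_curry
  refine (lowerSemicontinuous_indicator_sum_roots (n := n)
    (fun x => Matrix.charpoly_monic _) hnat
    (fun z => heval.comp (Continuous.prodMk_left z)) fun x hx z hz => ?_).measurable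
  refine lowerSemicontinuousAt_indicator_enorm_div_sq
    (b := fun x z => ((Matrix.of (Function.curry x)).charmatrix.adjugate j k).eval z)
    (q := fun x z => (Matrix.of (Function.curry x)).charpoly.derivative.eval z) ?_ ?_ hB
    (Polynomial.eval_derivative_ne_zero_of_nodup_roots hx hz)
  · simp only [Function.uncurry_def, eval_adjugate_charmatrix]
    have hcont : Continuous fun y : (Fin n × Fin n → ℂ) × ℂ =>
        Matrix.scalar (Fin n) y.2 - Matrix.of (Function.curry y.1) := by
      refine Continuous.sub ?_ ?_
      · exact Continuous.matrix_diagonal (continuous_pi fun _ => continuous_snd)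
      · refine continuous_matrix fun i l => ?_
        simp only [Matrix.of_apply, Function.curry_apply]
        fun_prop
    exact hcont.matrix_adjugate.matrix_elem j k
  · refine continuous_eval_of_continuous_coeff (n := n + 1)
      (p := fun x : Fin n × Fin n → ℂ => (Matrix.of (Function.curry x)).charpoly.derivative)
      (fun x => (Polynomial.natDegree_derivative_le _).trans_lt (by rw [hnat]; omega)) fun i => ?_
    simp only [Polynomial.coeff_derivative]
    exact (continuous_coeff_charpoly_curry (i + 1)).mul continuous_const

theorem of_curry_update {m R : Type*} [DecidableEq m] [Ring R] (x : m × m → R) (k j : m) (a : R) :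
    Matrix.of (Function.curry (Function.update x (k, j) a)) =
      (Matrix.of (Function.curry (Function.update x (k, j) 0))).updateRow k
        (Matrix.of (Function.curry (Function.update x (k, j) 0)) k + a • Pi.single j 1) := by
  ext i l
  rcases eq_or_ne i k with rfl | hi
  · rcases eq_or_ne l j with rfl | hl
    · simp
    · simp [hl]
  · simp [hi]

/-- The entry `(k, j)` is integrated first: its law is at most `c` times Lebesgue measure, and the
pencil bound is uniform in the other entries. -/
theorem lintegral_pi_indicator_sum_roots_charpoly_le {n : ℕ} (μ : Fin n × Fin n → Measure ℂ)
    [∀ i, IsProbabilityMeasure (μ i)] {c : ℝ≥0∞} (hμ : ∀ i, μ i ≤ c • volume) {B : Set ℂ}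
    (hB : IsOpen B) (j k : Fin n) :
    ∫⁻ x, ({x : Fin n × Fin n → ℂ | (Matrix.of (Function.curry x)).charpoly.roots.Nodup}.indicator
        fun x => ((Matrix.of (Function.curry x)).charpoly.roots.map (B.indicator fun z =>
          ‖((Matrix.of (Function.curry x)).charmatrix.adjugate j k).eval z /
            (Matrix.of (Function.curry x)).charpoly.derivative.eval z‖ₑ ^ 2)).sum) x
      ∂Measure.pi μ ≤ c * volume B := by
  set F : (Fin n × Fin n → ℂ) → ℝ≥0∞ := fun x =>
    ((Matrix.of (Function.curry x)).charpoly.roots.map (B.indicator fun z =>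
      ‖((Matrix.of (Function.curry x)).charmatrix.adjugate j k).eval z /
        (Matrix.of (Function.curry x)).charpoly.derivative.eval z‖ₑ ^ 2)).sum with hF
  have hle : ∀ x, ∫⁻ a, F (Function.update x (k, j) a) ∂μ (k, j) ≤ c * volume B := by
    intro x
    calc ∫⁻ a, F (Function.update x (k, j) a) ∂μ (k, j)
        ≤ ∫⁻ a, F (Function.update x (k, j) a) ∂(c • volume) := lintegral_mono' (hμ _) le_rfl
      _ = c * ∫⁻ a, F (Function.update x (k, j) a) := by rw [lintegral_smul_measure, smul_eq_mul]
      _ ≤ c * volume B := by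
        gcongr
        refine le_of_eq_of_le (lintegral_congr fun a => ?_) (lintegral_sum_roots_sub_C_mul_le
          (Matrix.of (Function.curry (Function.update x (k, j) 0))).charpoly
          ((Matrix.of (Function.curry (Function.update x (k, j) 0))).charmatrix.adjugate j k)
          hB.measurableSet)
        simp only [hF]
        rw [of_curry_update, charpoly_updateRow_add_smul_single,
          adjugate_charmatrix_updateRow_add_smul_single]
  refine (lintegral_le_of_lmarginal_le {(k, j)} (g := fun _ => c * volume B)
    (measurable_indicator_sum_roots_charpoly hB j k) measurable_const ?_).trans ?_
  · rw [lmarginal_singleton, lmarginal_singleton]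
    intro x
    simp only [lintegral_const, measure_univ, mul_one]
    -- The indicator serves measurability only; the inner bound holds without it.
    exact (lintegral_mono fun a => Set.indicator_le_self _ _ _).trans (hle x)
  · simp

theorem nullSingletonClass_of_le_smul_volume {ν : Measure ℂ} {c : ℝ≥0∞} (h : ν ≤ c • volume) :
    NullSingletonClass ν :=
  ⟨fun z => le_antisymm ((h {z}).trans_eq (by simp)) zero_le⟩

theorem aemeasurable_lintegral_sumSqEigenvalueCond_pi {n : ℕ} (μ : Fin n × Fin n → Measure ℂ)
    [∀ i, IsProbabilityMeasure (μ i)] {c : ℝ≥0∞} (hμ : ∀ i, μ i ≤ c • volume) {B : Set ℂ}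
    (hB : IsOpen B) :
    AEMeasurable (fun x => sumSqEigenvalueCond (Matrix.of (Function.curry x)) B) (Measure.pi μ) ∧
    ∫⁻ x, sumSqEigenvalueCond (Matrix.of (Function.curry x)) B ∂Measure.pi μ ≤
      (n : ℝ≥0∞) ^ 2 * (c * volume B) := by
  have := fun i => nullSingletonClass_of_le_smul_volume (hμ i)
  let U : Set (Fin n × Fin n → ℂ) :=
    {x | (Matrix.of (Function.curry x)).charpoly.roots.Nodup}
  have hae : (fun x => sumSqEigenvalueCond (Matrix.of (Function.curry x)) B) =ᵐ[Measure.pi μ]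
      fun x => ∑ j, ∑ k, U.indicator (fun x =>
        ((Matrix.of (Function.curry x)).charpoly.roots.map (B.indicator fun z =>
          ‖((Matrix.of (Function.curry x)).charmatrix.adjugate j k).eval z /
            (Matrix.of (Function.curry x)).charpoly.derivative.eval z‖ₑ ^ 2)).sum) x := by
    filter_upwards [ae_nodup_roots_charpoly μ] with x hx
    have hxU : x ∈ U := hx
    simp only [Set.indicator_of_mem hxU]
    exact sumSqEigenvalueCond_eq hx B
  have hmeas := fun j k : Fin n => measurable_indicator_sum_roots_charpoly hB j k
  refine ⟨⟨_, Finset.measurable_sum _ fun j _ => Finset.measurable_sum _ fun k _ => hmeas j k,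
    hae⟩, ?_⟩
  rw [lintegral_congr_ae hae, lintegral_finsetSum _ fun j _ =>
    Finset.measurable_sum _ fun k _ => hmeas j k]
  calc _ ≤ ∑ j : Fin n, ∑ k : Fin n, c * volume B := by
        refine Finset.sum_le_sum fun j _ => ?_
        rw [lintegral_finsetSum _ fun k _ => hmeas j k]
        exact Finset.sum_le_sum fun k _ =>
          lintegral_pi_indicator_sum_roots_charpoly_le μ hμ hB j k
    _ = _ := by
        simp only [Finset.sum_const, Finset.card_univ, Fintype.card_fin, nsmul_eq_mul]
        ring

/-! ### Transfer to the random matrix -/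

/-- Scaling by `s` in real dimension two multiplies area by `s²`, hence divides densities by it. -/
theorem map_add_mul_le_smul_volume {ν : Measure ℂ} {K : ℝ≥0∞} (hν : ν ≤ K • volume) (a : ℂ) {s : ℝ}
    (hs : s ≠ 0) : ν.map (fun z => a + (s : ℂ) * z) ≤
      (K * ENNReal.ofReal (s ^ 2)⁻¹) • (volume : Measure ℂ) := by
  have h1 : (fun z : ℂ => a + (s : ℂ) * z) = (fun z => a + z) ∘ fun z => s • z := by
    ext z; simp
  have hmeas : Measurable fun z : ℂ => a + (s : ℂ) * z := by fun_prop
  refine (Measure.map_mono hν hmeas).trans (le_of_eq ?_)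
  rw [Measure.map_smul, h1, ← Measure.map_map (by fun_prop) (by fun_prop),
    Measure.map_addHaar_smul volume hs, Measure.map_smul, map_add_left_eq_self, smul_smul,
    Complex.finrank_real_complex, abs_of_nonneg (by positivity)]

theorem HasContDensityLE.map_le {Ω : Type*} [MeasurableSpace Ω] {X : Ω → ℂ} {P : Measure Ω} {K : ℝ}
    (h : HasContDensityLE X P K) : P.map X ≤ ENNReal.ofReal K • volume := by
  obtain ⟨f, -, -, hf, heq⟩ := h
  rw [heq, ← withDensity_const]
  exact withDensity_mono (Filter.Eventually.of_forall fun z => ENNReal.ofReal_le_ofReal (hf z))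

theorem HasContDensityLE.nonneg {Ω : Type*} [MeasurableSpace Ω] {X : Ω → ℂ} {P : Measure Ω} {K : ℝ}
    (h : HasContDensityLE X P K) : 0 ≤ K := by
  obtain ⟨f, -, h0, hf, -⟩ := h
  exact (h0 0).trans (hf 0)

theorem mainTheorem9 {Ω Ω' : Type*} [MeasurableSpace Ω] [MeasurableSpace Ω']
    (P : Measure Ω) [IsProbabilityMeasure P] (P' : Measure Ω') [IsProbabilityMeasure P']
    (ξ : Ω' → ℂ) (hξ : AEMeasurable ξ P') (hsub : IsSubGaussian ξ P')
    (K : ℝ) (hK : HasContDensityLE ξ P' K)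
    (n : ℕ) (G : Ω → Matrix (Fin n) (Fin n) ℂ) (hG : IsIIDMatrix G P ξ P')
    (A : Matrix (Fin n) (Fin n) ℂ)
    (hA : ‖Matrix.toEuclideanCLM (n := Fin n) (𝕜 := ℂ) A‖ ≤ 1)
    (δ : ℝ) (hδ : δ ∈ Set.Ioo (0 : ℝ) 1) :
    (∀ᵐ ω ∂P, (A + (δ : ℂ) • G ω).charpoly.roots.Nodup) ∧
    ∀ B : Set ℂ, IsOpen B →
      AEMeasurable (fun ω => sumSqEigenvalueCond (A + (δ : ℂ) • G ω) B) P ∧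
      ∫⁻ ω, sumSqEigenvalueCond (A + (δ : ℂ) • G ω) B ∂P ≤
        ENNReal.ofReal (Real.exp 1 * K * (n : ℝ) ^ 3 / δ ^ 2) * volume B := by
  have hδ0 : 0 < δ := hδ.1
  let s : ℝ := δ / √(n : ℝ)
  let φ : Fin n × Fin n → ℂ → ℂ := fun p z => A p.1 p.2 + (s : ℂ) * z
  have hφ : ∀ p, Measurable (φ p) := fun p => by fun_prop
  let Y : Fin n × Fin n → Ω → ℂ := fun p ω => ((√(n : ℝ) : ℝ) : ℂ) * G ω p.1 p.2
  have hY : ∀ p, AEMeasurable (Y p) P := fun p => (hG.identDistrib p.1 p.2).aemeasurable_fst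
  let X : Fin n × Fin n → Ω → ℂ := fun p => φ p ∘ Y p
  have hX : ∀ p, AEMeasurable (X p) P := fun p => (hφ p).comp_aemeasurable (hY p)
  -- Positivity is drawn from an index, so `n = 0` needs no separate case.
  have hn : ∀ _ : Fin n × Fin n, 0 < √(n : ℝ) := fun p =>
    Real.sqrt_pos.2 (Nat.cast_pos.2 (Fin.pos p.1))
  have hXM : ∀ ω, Matrix.of (Function.curry fun p => X p ω) = A + (δ : ℂ) • G ω := by
    intro ω
    ext i j
    have h0 : ((√(n : ℝ) : ℝ) : ℂ) ≠ 0 := Complex.ofReal_ne_zero.2 (hn (i, j)).ne'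
    simp only [Matrix.of_apply, Function.curry_apply, X, φ, Y, s, Function.comp_apply,
      Matrix.add_apply, Matrix.smul_apply, smul_eq_mul, Complex.ofReal_div]
    field_simp
  let μ : Fin n × Fin n → Measure ℂ := fun p => P.map (X p)
  have hprob : ∀ p, IsProbabilityMeasure (μ p) := fun p => Measure.isProbabilityMeasure_map (hX p)
  have hmap : P.map (fun ω p => X p ω) = Measure.pi μ :=
    (hG.indep.comp φ hφ).map_fun_eq_pi_map hX
  -- This is `K / s²` with `s² = δ²/n`.
  let c : ℝ≥0∞ := ENNReal.ofReal (K * n / δ ^ 2)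
  have hμ : ∀ p, μ p ≤ c • volume := by
    intro p
    have h1 : μ p = (P'.map ξ).map (φ p) := by
      rw [← (hG.identDistrib p.1 p.2).map_eq, AEMeasurable.map_map_of_aemeasurable
        (hφ p).aemeasurable (hY p)]
    have hs : s ≠ 0 := (div_pos hδ0 (hn p)).ne'
    refine h1.trans_le ((map_add_mul_le_smul_volume hK.map_le (A p.1 p.2) hs).trans (le_of_eq ?_))
    rw [← ENNReal.ofReal_mul hK.nonneg, div_pow, Real.sq_sqrt (Nat.cast_nonneg n), inv_div,
      ← mul_div_assoc]
  have hXae : AEMeasurable (fun ω p => X p ω) P := aemeasurable_pi_lambda _ hX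
  have hnull := fun p => nullSingletonClass_of_le_smul_volume (hμ p)
  refine ⟨?_, fun B hB => ?_⟩
  · have h := ae_nodup_roots_charpoly μ
    rw [← hmap] at h
    filter_upwards [ae_of_ae_map hXae h] with ω hω
    rwa [hXM] at hω
  · obtain ⟨h1, h2⟩ := aemeasurable_lintegral_sumSqEigenvalueCond_pi μ hμ hB
    rw [← hmap] at h1 h2
    have h3 := h1.comp_aemeasurable hXae
    rw [lintegral_map' h1 hXae] at h2
    simp only [Function.comp_def, hXM] at h2 h3
    refine ⟨h3, h2.trans ?_⟩
    rw [← mul_assoc]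
    gcongr
    rw [← ENNReal.ofReal_natCast, ← ENNReal.ofReal_pow (Nat.cast_nonneg n),
      ← ENNReal.ofReal_mul (by positivity)]
    refine ENNReal.ofReal_le_ofReal ?_
    have hK0 := hK.nonneg
    -- The argument yields the constant `1`; the factor `e` is slack.
    calc (n : ℝ) ^ 2 * (K * n / δ ^ 2) = 1 * (K * n ^ 3 / δ ^ 2) := by ring
      _ ≤ Real.exp 1 * (K * n ^ 3 / δ ^ 2) := by
        gcongr
        exact Real.one_le_exp zero_le_one
      _ = _ := by ring
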